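/- Let $\alpha\in(0,1)$, $1<p<\frac1{1-\alpha}$, $T>0$, $K\ge 0$, $\nu>0$, and let $N>1$, $d\ge1$ be integers. Let $a_{ij}\ge0$ and $c_i\ge0$ ($i,j=1,\dots,N$) be constants and $x_{00},x_{10},\dots,x_{N0}\in\mathbb R^d$. Write $\|\cdot\|$ for the Euclidean norm on $\mathbb R^d$. For $\beta>0$ and an integrable $f$ on $[0,T]$ let $$I^{\beta}_{0+}[f](t)=\frac1{\Gamma(\beta)}\int_0^t\frac{f(\tau)}{(t-\tau)^{1-\beta}}\,d\tau\quad\text{for a.e. }t\in[0,T],$$ and, when $I^{1-\alpha}_{0+}[f]$ has an absolutely continuous representative on $[0,T]$, let $D^{\alpha}_{0+}[f]=\frac{d}{dt}I^{1-\alpha}_{0+}[f]$ be the Riemann–Liouville derivative, with $I^{1-\alpha}_{0+}[f](0)$ the value of that representative at $0$. Let $$\mathcal U_M=\{u\in L^1([0,T];\mathbb R^d):\ \|u(t)\|\le K,\ t\in[0,T]\}.$$ Call $(x,u)$ admissible if $u\in\mathcal U_M$ and $x=(x_0,x_1,\dots,x_N)\in L^1([0,T];(\mathbb R^d)^{N+1})$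 is such that $I^{1-\alpha}_{0+}[x]$ has an absolutely continuous representative on $[0,T]$ and, for a.e. $t\in[0,T]$ and $i=1,\dots,N$, $$D^\alpha_{0+}[x_0](t)=u(t),\qquad D^\alpha_{0+}[x_i](t)=\sum_{j=1}^N a_{ij}\,(x_j(t)-x_i(t))+c_i\,(x_0(t)-x_i(t)),$$ with $I^{1-\alpha}_{0+}[x_j](0)=x_{j0}$ for $j=0,1,\dots,N$. Then there is an admissible pair $(x_*,u_*)$ that minimizes the cost $$J(x,u)=\int_0^T\Bigl[\frac1{2N^2}\sum_{i,j=1}^N\|x_i(t)-x_j(t)\|^2+\frac12\sum_{i=1}^N\|x_0(t)-x_i(t)\|^2+\frac\nu2\|u(t)\|^2\Bigr]dt\in[0,\infty]$$ over all admissible pairs $(x,u)$, and it satisfies $$(x_*,u_*)\in\Bigl(I^\alpha_{0+}\bigl(L^p([0,T];(\mathbb R^d)^{N+1})\bigr)+\Bigl\{\frac{c}{t^{1-\alpha}}:\ c\in(\mathbb R^d)^{N+1}\Bigr\}\Bigr)\times\mathcal U_M .$$ -/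

import Mathlib

open MeasureTheory Set

noncomputable section

/-- The left Riemann–Liouville fractional integral of order `α` with lower limit `0`,
`I^α_{0+}[f](t) = (1 / Γ(α)) ∫_0^t f(τ) / (t - τ)^{1-α} dτ`. -/
def rlIntegral {E : Type*} [NormedAddCommGroup E] [NormedSpace ℝ E]
    (α : ℝ) (f : ℝ → E) (t : ℝ) : E :=
  (1 / Real.Gamma α) • ∫ τ in (0 : ℝ)..t, (1 / (t - τ) ^ (1 - α)) • f τ

/-- `f ∈ L¹([0,T])` has left Riemann–Liouville derivative `D^α_{0+}[f] = v` a.e. on `[0,T]`, with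
initial value `I^{1-α}_{0+}[f](0) = y₀`. The function `I^{1-α}_{0+}[f]` is defined almost everywhere;
it is required to have an absolutely continuous representative `F` on `[0,T]`, and the derivative
and the value at `0` are those of `F`. -/
def HasRLDerivWithInit {E : Type*} [NormedAddCommGroup E] [NormedSpace ℝ E]
    (α T : ℝ) (f v : ℝ → E) (y₀ : E) : Prop :=
  IntegrableOn f (Icc 0 T) ∧
    ∃ F : ℝ → E, AbsolutelyContinuousOnInterval F 0 T ∧
      (∀ᵐ t ∂volume.restrict (Icc 0 T), F t = rlIntegral (1 - α) f t) ∧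
      (∀ᵐ t ∂volume.restrict (Icc 0 T), HasDerivAt F (v t) t) ∧
      F 0 = y₀

/-- Membership (up to a null set) in
`I^α_{0+}(L^p([0,T]; E)) + {c / t^{1-α} : c ∈ E}`. -/
def MemRLSpace {E : Type*} [NormedAddCommGroup E] [NormedSpace ℝ E]
    (α p T : ℝ) (x : ℝ → E) : Prop :=
  ∃ g : ℝ → E, MemLp g (ENNReal.ofReal p) (volume.restrict (Icc 0 T)) ∧
    ∃ c : E, ∀ᵐ t ∂volume.restrict (Icc 0 T),
      x t = rlIntegral α g t + (1 / t ^ (1 - α)) • c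

namespace HegselmannKrause

/-- Opinions of the leader (index `0`) and of the `N` agents (indices `1, …, N`) in `ℝ^d`. -/
abbrev State (N d : ℕ) : Type := Fin (N + 1) → EuclideanSpace ℝ (Fin d)

/-- The right-hand side of the controlled system: `u` for the leader and
`∑_j a_{ij} (x_j - x_i) + c_i (x_0 - x_i)` for the `i`-th agent. -/
def field {N d : ℕ} (a : Fin N → Fin N → ℝ) (c : Fin N → ℝ)
    (x : State N d) (u : EuclideanSpace ℝ (Fin d)) : State N d :=
  Fin.cons u fun i : Fin N =>
    (∑ j : Fin N, a i j • (x j.succ - x i.succ)) + c i • (x 0 - x i.succ)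

/-- The running cost. -/
def runningCost {N d : ℕ} (ν : ℝ) (x : State N d) (u : EuclideanSpace ℝ (Fin d)) : ℝ :=
  1 / (2 * (N : ℝ) ^ 2) * ∑ i : Fin N, ∑ j : Fin N, ‖x i.succ - x j.succ‖ ^ 2
    + 1 / 2 * ∑ i : Fin N, ‖x 0 - x i.succ‖ ^ 2
    + ν / 2 * ‖u‖ ^ 2

/-- The cost functional. The running cost is nonnegative, so its integral over `[0,T]` is a
Lebesgue integral with values in `[0,∞]`. -/
def cost {N d : ℕ} (ν T : ℝ) (x : ℝ → State N d) (u : ℝ → EuclideanSpace ℝ (Fin d)) : ENNReal :=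
  ∫⁻ t in Icc 0 T, ENNReal.ofReal (runningCost ν (x t) (u t))

/-- The set `𝒰_M` of integrable controls on `[0,T]` with values in the closed ball of radius `K`. -/
def controls (d : ℕ) (K T : ℝ) : Set (ℝ → EuclideanSpace ℝ (Fin d)) :=
  {u | IntegrableOn u (Icc 0 T) ∧ ∀ t ∈ Icc 0 T, ‖u t‖ ≤ K}

/-- The pair `(x, u)` is admissible: `u ∈ 𝒰_M`, and `x` solves the system driven by `u` with
`I^{1-α}_{0+}[x](0) = x₀`. -/
def IsAdmissible {N d : ℕ} (α K T : ℝ) (a : Fin N → Fin N → ℝ) (c : Fin N → ℝ) (x₀ : State N d)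
    (x : ℝ → State N d) (u : ℝ → EuclideanSpace ℝ (Fin d)) : Prop :=
  u ∈ controls d K T ∧ HasRLDerivWithInit α T x (fun t => field a c (x t) (u t)) x₀

end HegselmannKrause

end

/-! The right-hand side of the system is linear, `A x + B u`. Since `I^{1-α} I^α` is the primitive,
`I^{1-α}` is injective on `L¹`, and `I^{1-α}` sends `t^{α-1}` to the constant `Γ(α)`, the initial
value problem is equivalent to the Volterra equation `x = I^α[A x + B u] + t^{α-1} x₀ / Γ(α)`
(`hasRLDerivWithInit_iff`).

With the weight `e^{-st}`, the operator `I^α` becomes convolution with a kernel of mass `s^{-α}`, so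
it is as small as desired on weighted `L¹`. Hence every control has a trajectory, by the contraction
principle, and trajectories are Lipschitz in the control (`exists_volterra_solution`,
`exists_volterra_stability`).

The minimizer comes from the direct method without weak compactness. Midpoints of admissible pairs
are admissible, and the parallelogram identity makes the cost strongly convex in the control, so the
controls of a minimizing sequence are Cauchy in `L¹` (`exists_integral_norm_sub_lt`). By stability
the states converge too; along a subsequence both converge a.e., and Fatou's lemma concludes.

The regularity holds for every admissible pair. Young's inequality gives `I^α : L¹ → L^p` when `p (1
- α) < 1`, so `x`, and with it `A x + B u`, lies in `L^p`; the Volterra equation is then the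
required representation. -/

/-! ### Absolutely continuous functions as primitives. -/

section AbsolutelyContinuous

open Filter AbsolutelyContinuousOnInterval
open scoped Topology

variable {E : Type*} [NormedAddCommGroup E] [NormedSpace ℝ E]

/-- The primitive of an integrable vector-valued function is absolutely continuous. -/
theorem IntervalIntegrable.absolutelyContinuousOnInterval_primitive {f : ℝ → E}
    {a b c : ℝ} (h : IntervalIntegrable f volume a b) (hc : c ∈ uIcc a b) :
    AbsolutelyContinuousOnInterval (fun x ↦ ∫ v in c..x, f v) a b := by
  -- Increments of the primitive of `f` are dominated by those of the scalar primitive of `‖f‖`.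
  have hR := h.norm.absolutelyContinuousOnInterval_intervalIntegral hc
  refine squeeze_zero' (.of_forall fun E ↦ Finset.sum_nonneg fun _ _ ↦ dist_nonneg) ?_ hR
  have : ∀ᶠ (E : ℕ × (ℕ → ℝ × ℝ)) in totalLengthFilter ⊓ 𝓟 (disjWithin a b),
      E ∈ disjWithin a b := eventually_inf_principal.mpr (by simp)
  filter_upwards [this] with ⟨n, I⟩ hnI
  refine Finset.sum_le_sum fun i hi ↦ ?_
  obtain ⟨h₁, h₂⟩ := hnI.1 i hi
  have hsub : ∀ x ∈ uIcc a b, IntervalIntegrable f volume c x := fun x hx ↦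
    h.mono_set (uIcc_subset_uIcc hc hx)
  rw [dist_eq_norm, Real.dist_eq,
    intervalIntegral.integral_interval_sub_left (hsub _ h₁) (hsub _ h₂),
    intervalIntegral.integral_interval_sub_left (hsub _ h₁).norm (hsub _ h₂).norm]
  exact intervalIntegral.norm_integral_le_abs_integral_norm

/-- An absolutely continuous function with integrable a.e. derivative `v` is a primitive of `v`. -/
theorem AbsolutelyContinuousOnInterval.eq_add_integral [CompleteSpace E] {F v : ℝ → E} {a b : ℝ}
    (hF : AbsolutelyContinuousOnInterval F a b) (hv : IntervalIntegrable v volume a b)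
    (hd : ∀ᵐ x, x ∈ uIcc a b → HasDerivAt F (v x) x) :
    ∀ x ∈ uIcc a b, F x = F a + ∫ t in a..x, v t := by
  -- `F` minus the primitive of `v` is absolutely continuous with derivative zero a.e., hence
  -- constant.
  have hac := hF.sub (hv.absolutelyContinuousOnInterval_primitive (c := a) (by simp))
  obtain ⟨C, hC⟩ := hac.const_of_ae_hasDerivAt_zero (by
    filter_upwards [hd, hv.ae_hasDerivAt_integral] with x h₁ h₂ hx
    simpa using (h₁ hx).sub (h₂ hx a (by simp)))
  intro x hx
  have h₁ := hC x hx
  have h₂ := hC a (by simp)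
  simp only [Pi.sub_apply, intervalIntegral.integral_same, sub_zero] at h₁ h₂
  rw [h₂, ← h₁]; abel

end AbsolutelyContinuous

/-! ### Damped Riemann–Liouville kernels. -/

section Kernel

open Real

/-- The Beta integral on `[0, a]` for complementary exponents. -/
theorem integral_rpow_mul_rpow_sub_eq_Gamma {s a : ℝ} (hs₀ : 0 < s) (hs₁ : s < 1) (ha : 0 < a) :
    ∫ x in (0 : ℝ)..a, x ^ (s - 1) * (a - x) ^ (-s) = Gamma s * Gamma (1 - s) := by
  have h := Complex.betaIntegral_scaled (s : ℂ) ((1 - s : ℝ) : ℂ) ha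
  have hB := Complex.Gamma_mul_Gamma_eq_betaIntegral (s := (s : ℂ)) (t := ((1 - s : ℝ) : ℂ))
    (by simpa) (by simpa using hs₁)
  -- The exponents sum to one, so the scaling factor is `a ^ 0` and the value does not depend on
  -- `a`.
  have e : (s : ℂ) + ((1 - s : ℝ) : ℂ) = 1 := by push_cast; ring
  rw [e, Complex.Gamma_one, one_mul] at hB
  rw [e, sub_self, Complex.cpow_zero, one_mul, ← hB, Complex.Gamma_ofReal,
    Complex.Gamma_ofReal] at h
  rw [← Complex.ofReal_inj, ← intervalIntegral.integral_ofReal]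
  push_cast
  rw [← h]
  refine intervalIntegral.integral_congr fun x hx ↦ ?_
  rw [uIcc_of_le ha.le] at hx
  rw [Complex.ofReal_cpow hx.1, Complex.ofReal_cpow (sub_nonneg.2 hx.2)]
  congr 2 <;> push_cast <;> ring

/-- The exponentially damped Riemann–Liouville kernel of order `β`. -/
noncomputable def rlKernel (β s : ℝ) : ℝ → ℝ :=
  indicator (Ioi 0) fun t ↦ (1 / Gamma β) * (t ^ (β - 1) * exp (-(s * t)))

theorem rlKernel_of_pos {β s t : ℝ} (ht : 0 < t) :
    rlKernel β s t = (1 / Gamma β) * (t ^ (β - 1) * exp (-(s * t))) :=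
  indicator_of_mem (mem_Ioi.2 ht) _

theorem rlKernel_of_nonpos {β s t : ℝ} (ht : t ≤ 0) : rlKernel β s t = 0 :=
  indicator_of_notMem (by simpa using ht) _

theorem rlKernel_nonneg {β : ℝ} (hβ : 0 < β) (s t : ℝ) : 0 ≤ rlKernel β s t :=
  indicator_nonneg (fun t (ht : 0 < t) ↦ by positivity) t

theorem measurable_rlKernel (β s : ℝ) : Measurable (rlKernel β s) := by
  unfold rlKernel
  exact Measurable.indicator (by fun_prop) measurableSet_Ioi

/-- This mass tends to zero as `s → ∞`, which is the source of every contraction estimate below. -/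
theorem integral_rlKernel {β s : ℝ} (hβ : 0 < β) (hs : 0 < s) :
    ∫ t, rlKernel β s t = (1 / s) ^ β := by
  rw [rlKernel, integral_indicator measurableSet_Ioi, integral_const_mul,
    integral_rpow_mul_exp_neg_mul_Ioi hβ hs]
  have := (Gamma_pos_of_pos hβ).ne'
  field_simp

theorem integrable_rlKernel {β s : ℝ} (hβ : 0 < β) (hs : 0 < s) :
    Integrable (rlKernel β s) := by
  -- The integral of a non-integrable function is zero by convention, so a nonzero value proves
  -- integrability.
  refine Integrable.of_integral_ne_zero ?_
  rw [integral_rlKernel hβ hs]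
  positivity

/-- The damped kernels of complementary orders convolve to the damped Heaviside function. -/
theorem rlKernel_convolution_rlKernel {β s : ℝ} (hβ₀ : 0 < β) (hβ₁ : β < 1) (x : ℝ) :
    convolution (rlKernel β s) (rlKernel (1 - β) s) (ContinuousLinearMap.lsmul ℝ ℝ) volume x =
      indicator (Ioi 0) (fun t ↦ exp (-(s * t))) x := by
  rw [rlKernel, rlKernel, ← posConvolution_eq_convolution_indicator _ _ _ volume, posConvolution]
  refine congrFun (indicator_congr fun x hx ↦ ?_) x
  have hx : 0 < x := hx
  have h := integral_rpow_mul_rpow_sub_eq_Gamma hβ₀ hβ₁ hx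
  have h₁ := (Gamma_pos_of_pos hβ₀).ne'
  have h₂ := (Gamma_pos_of_pos (sub_pos.2 hβ₁)).ne'
  calc _ = ∫ t in (0 : ℝ)..x, exp (-(s * x)) * (1 / (Gamma β * Gamma (1 - β))) *
        (t ^ (β - 1) * (x - t) ^ (-β)) := by
        refine intervalIntegral.integral_congr fun t _ ↦ ?_
        have : exp (-(s * x)) = exp (-(s * t)) * exp (-(s * (x - t))) := by
          rw [← exp_add]; ring_nf
        simp only [ContinuousLinearMap.lsmul_apply, smul_eq_mul, this]
        rw [show 1 - β - 1 = -β by ring]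
        field_simp
    _ = _ := by
      rw [intervalIntegral.integral_const_mul, h]
      field_simp

end Kernel

/-! ### The fractional integral as a convolution. -/

section RLIntegral

open Real

variable {E : Type*} [NormedAddCommGroup E] [NormedSpace ℝ E]

/-- The function `e^{-st} f(t)`, extended by zero outside `[0,T]`. -/
noncomputable def dampedExtension (s T : ℝ) (f : ℝ → E) : ℝ → E :=
  indicator (Icc 0 T) fun t ↦ exp (-(s * t)) • f t

theorem dampedExtension_of_mem {s T t : ℝ} (f : ℝ → E) (ht : t ∈ Icc 0 T) :
    dampedExtension s T f t = exp (-(s * t)) • f t :=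
  indicator_of_mem ht _

theorem integrable_dampedExtension {s T : ℝ} {f : ℝ → E} (hf : IntegrableOn f (Icc 0 T)) :
    Integrable (dampedExtension s T f) := by
  rw [dampedExtension, integrable_indicator_iff measurableSet_Icc]
  exact hf.continuousOn_smul (by fun_prop) isCompact_Icc

theorem integral_norm_dampedExtension (s T : ℝ) (f : ℝ → E) :
    ∫ t, ‖dampedExtension s T f t‖ = ∫ t in Icc 0 T, exp (-(s * t)) * ‖f t‖ := by
  rw [← integral_indicator measurableSet_Icc]
  congr 1 with t
  rw [dampedExtension, norm_indicator_eq_indicator_norm]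
  refine congrFun (indicator_congr fun t _ ↦ ?_) t
  rw [norm_smul, norm_of_nonneg (exp_pos _).le]

/-- On `[0,T]`, the damped fractional integral is a convolution. -/
theorem rlKernel_convolution_dampedExtension (β s : ℝ) {T t : ℝ} (f : ℝ → E)
    (ht : t ∈ Icc 0 T) :
    convolution (rlKernel β s) (dampedExtension s T f) (ContinuousLinearMap.lsmul ℝ ℝ) volume t =
      exp (-(s * t)) • rlIntegral β f t := by
  rw [convolution_eq_swap, rlIntegral, intervalIntegral.integral_of_le ht.1,
    ← integral_smul, ← integral_smul, ← integral_indicator measurableSet_Ioc]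
  -- Endpoints are discarded: `0` is in `Icc 0 T` but not in `Ioc 0 t`, and at `τ = t` `rlKernel` is
  -- zero by definition while the integrand need not be.
  have h₀ : ∀ᵐ τ : ℝ, τ ≠ 0 := by simp [ae_iff, measure_singleton]
  have h₁ : ∀ᵐ τ : ℝ, τ ≠ t := by simp [ae_iff, measure_singleton]
  refine integral_congr_ae ?_
  filter_upwards [h₀, h₁] with τ h₀ h₁
  simp only [ContinuousLinearMap.lsmul_apply]
  by_cases hτ : τ ∈ Ioc 0 t
  · have hlt : 0 < t - τ := sub_pos.2 (lt_of_le_of_ne hτ.2 h₁)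
    rw [indicator_of_mem hτ, rlKernel_of_pos hlt,
      dampedExtension_of_mem f ⟨hτ.1.le, hτ.2.trans ht.2⟩, smul_smul, smul_smul, smul_smul]
    congr 1
    have e : exp (-(s * t)) = exp (-(s * (t - τ))) * exp (-(s * τ)) := by
      rw [← exp_add]; ring_nf
    rw [e, show β - 1 = -(1 - β) by ring, rpow_neg hlt.le]
    ring
  · rw [indicator_of_notMem hτ]
    by_cases hlt : τ < t
    · have : τ ∉ Icc 0 T := fun h ↦ hτ ⟨lt_of_le_of_ne h.1 h₀.symm, hlt.le⟩
      simp [dampedExtension, this]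
    · rw [rlKernel_of_nonpos (by linarith), zero_smul]

/-- The fractional integral on `[0,T]` in terms of the convolution. -/
theorem rlIntegral_eq_smul_convolution (β s : ℝ) {T t : ℝ} (f : ℝ → E) (ht : t ∈ Icc 0 T) :
    rlIntegral β f t = exp (s * t) • convolution (rlKernel β s) (dampedExtension s T f)
      (ContinuousLinearMap.lsmul ℝ ℝ) volume t := by
  rw [rlKernel_convolution_dampedExtension β s f ht, smul_smul, ← exp_add]
  simp

/-- The indicator is needed because the convolution need not vanish to the right of `T`. -/
theorem dampedExtension_rlIntegral (β s T : ℝ) (f : ℝ → E) :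
    dampedExtension s T (rlIntegral β f) = indicator (Icc 0 T) (convolution (rlKernel β s)
      (dampedExtension s T f) (ContinuousLinearMap.lsmul ℝ ℝ) volume) := by
  rw [dampedExtension]
  exact indicator_congr fun t ht ↦ (rlKernel_convolution_dampedExtension β s f ht).symm

theorem rlIntegral_congr_ae (β : ℝ) {T : ℝ} {f g : ℝ → E}
    (h : ∀ᵐ t ∂volume.restrict (Icc 0 T), f t = g t) :
    ∀ t ∈ Icc 0 T, rlIntegral β f t = rlIntegral β g t := by
  intro t ht
  rw [rlIntegral, rlIntegral]
  congr 1
  refine intervalIntegral.integral_congr_ae ?_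
  rw [ae_restrict_iff' measurableSet_Icc] at h
  filter_upwards [h] with τ hτ hm
  rw [uIoc_of_le ht.1] at hm
  rw [hτ ⟨hm.1.le, hm.2.trans ht.2⟩]

theorem integrableOn_rlIntegral {β T : ℝ} (hβ : 0 < β) {f : ℝ → E}
    (hf : IntegrableOn f (Icc 0 T)) : IntegrableOn (rlIntegral β f) (Icc 0 T) := by
  have h := ((integrable_rlKernel hβ one_pos).integrable_convolution
    (ContinuousLinearMap.lsmul ℝ ℝ) (integrable_dampedExtension (s := 1) hf)).integrableOn
      (s := Icc 0 T)
  refine (h.continuousOn_smul (f := fun t ↦ exp (1 * t)) (by fun_prop) isCompact_Icc).congr_fun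
    (fun t ht ↦ ?_) measurableSet_Icc
  exact (rlIntegral_eq_smul_convolution β 1 f ht).symm

/-- The fractional integral is linear, a.e. on `[0,T]`. -/
theorem rlIntegral_linear_ae {β T : ℝ} (hβ : 0 < β) {f g : ℝ → E}
    (hf : IntegrableOn f (Icc 0 T)) (hg : IntegrableOn g (Icc 0 T)) (a b : ℝ) :
    ∀ᵐ t ∂volume.restrict (Icc 0 T), rlIntegral β (fun τ ↦ a • f τ + b • g τ) t =
      a • rlIntegral β f t + b • rlIntegral β g t := by
  have hk := integrable_rlKernel hβ one_pos
  -- Additivity can fail at points where an integral diverges and takes its default value; both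
  -- convolutions exist a.e.
  have hf' := (hk.ae_convolution_exists (ContinuousLinearMap.lsmul ℝ ℝ)
    (integrable_dampedExtension (s := 1) (hf.smul a)))
  have hg' := (hk.ae_convolution_exists (ContinuousLinearMap.lsmul ℝ ℝ)
    (integrable_dampedExtension (s := 1) (hg.smul b)))
  rw [ae_restrict_iff' measurableSet_Icc]
  have ext_smul : ∀ (a : ℝ) (f : ℝ → E), dampedExtension 1 T (a • f) =
      a • dampedExtension 1 T f := fun a f ↦ by
    ext t
    by_cases hm : t ∈ Icc 0 T <;> simp [dampedExtension, hm, smul_comm a]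
  have ext_add : dampedExtension 1 T (fun τ ↦ a • f τ + b • g τ) =
      dampedExtension 1 T (a • f) + dampedExtension 1 T (b • g) := by
    ext t
    by_cases hm : t ∈ Icc 0 T <;> simp [dampedExtension, hm]
  filter_upwards [hf', hg'] with t hf' hg' ht
  rw [rlIntegral_eq_smul_convolution β 1 _ ht, rlIntegral_eq_smul_convolution β 1 f ht,
    rlIntegral_eq_smul_convolution β 1 g ht, ext_add, ConvolutionExistsAt.distrib_add hf' hg',
    ext_smul, ext_smul, convolution_smul, convolution_smul, smul_add]
  simp only [Pi.smul_apply, smul_comm (exp (1 * t))]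

/-- Exponential weights make the fractional integral small in `L¹`. -/
theorem integral_exp_mul_norm_rlIntegral_le {β s T : ℝ} (hβ : 0 < β) (hs : 0 < s) {f : ℝ → E}
    (hf : IntegrableOn f (Icc 0 T)) :
    ∫ t in Icc 0 T, exp (-(s * t)) * ‖rlIntegral β f t‖ ≤
      (1 / s) ^ β * ∫ t in Icc 0 T, exp (-(s * t)) * ‖f t‖ := by
  have hk := integrable_rlKernel hβ hs
  have hd := integrable_dampedExtension (s := s) hf
  have hc := hk.integrable_convolution (ContinuousLinearMap.lsmul ℝ ℝ) hd
  have hn := hk.norm.integrable_convolution (ContinuousLinearMap.mul ℝ ℝ) hd.norm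
  rw [← integral_norm_dampedExtension, ← integral_norm_dampedExtension,
    dampedExtension_rlIntegral]
  -- The norm of a convolution is at most the convolution of the norms, whose total integral is the
  -- product of the two masses.
  calc _ ≤ ∫ t, convolution (fun t ↦ ‖rlKernel β s t‖) (fun t ↦ ‖dampedExtension s T f t‖)
        (ContinuousLinearMap.mul ℝ ℝ) volume t := by
        refine integral_mono_of_nonneg (.of_forall fun t ↦ norm_nonneg _) hn
          (.of_forall fun t ↦ (norm_indicator_le_norm_self _ t).trans ?_)
        refine (norm_integral_le_integral_norm _).trans_eq ?_
        simp [convolution, norm_smul]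
    _ = _ := by
      rw [integral_convolution _ hk.norm hd.norm]
      simp only [norm_of_nonneg (rlKernel_nonneg hβ s _), integral_rlKernel hβ hs,
        ContinuousLinearMap.mul_apply']

/-- Fractional integrals of complementary orders compose to the primitive. -/
theorem rlIntegral_rlIntegral_ae [CompleteSpace E] {β T : ℝ} (hβ₀ : 0 < β) (hβ₁ : β < 1)
    {f : ℝ → E} (hf : IntegrableOn f (Icc 0 T)) :
    ∀ᵐ t ∂volume.restrict (Icc 0 T), rlIntegral β (rlIntegral (1 - β) f) t =
      ∫ τ in (0 : ℝ)..t, f τ := by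
  have hk := integrable_rlKernel hβ₀ one_pos
  have hk' := integrable_rlKernel (sub_pos.2 hβ₁) one_pos
  have hd := integrable_dampedExtension (s := 1) hf
  -- Absolute convergence of the triple convolution, which associativity requires.
  have hx := hk.norm.ae_convolution_exists (ContinuousLinearMap.mul ℝ ℝ)
    (hk'.norm.integrable_convolution (ContinuousLinearMap.mul ℝ ℝ) hd.norm)
  rw [ae_restrict_iff' measurableSet_Icc]
  filter_upwards [hx] with t hx ht
  have assoc := convolution_assoc (ContinuousLinearMap.lsmul ℝ ℝ) (ContinuousLinearMap.lsmul ℝ ℝ)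
    (ContinuousLinearMap.lsmul ℝ ℝ) (ContinuousLinearMap.lsmul ℝ ℝ)
    (fun x y z ↦ by simp [smul_smul, mul_comm]) hk.aestronglyMeasurable hk'.aestronglyMeasurable
    hd.aestronglyMeasurable (hk.ae_convolution_exists _ hk')
    (hk'.norm.ae_convolution_exists _ hd.norm) hx
  have e₁ : rlIntegral β (rlIntegral (1 - β) f) t = exp (1 * t) • convolution (rlKernel β 1)
      (convolution (rlKernel (1 - β) 1) (dampedExtension 1 T f)
        (ContinuousLinearMap.lsmul ℝ ℝ) volume) (ContinuousLinearMap.lsmul ℝ ℝ) volume t := by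
    rw [rlIntegral_eq_smul_convolution β 1 _ ht, dampedExtension_rlIntegral]
    congr 1
    rw [convolution_eq_swap, convolution_eq_swap]
    congr 1 with τ
    -- The indicator may be dropped: for `τ ≥ t` the outer kernel vanishes, and for `τ < 0` the
    -- inner convolution does.
    by_cases hτ : τ ∈ Icc 0 T
    · rw [indicator_of_mem hτ]
    · rw [indicator_of_notMem hτ]
      rcases le_total t τ with h | h
      · rw [rlKernel_of_nonpos (by linarith)]; simp
      · have hτ0 : τ < 0 := by
          by_contra h0
          exact hτ ⟨not_lt.1 h0, h.trans ht.2⟩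
        have : convolution (rlKernel (1 - β) 1) (dampedExtension 1 T f)
            (ContinuousLinearMap.lsmul ℝ ℝ) volume τ = 0 := by
          rw [convolution_eq_swap]
          refine integral_eq_zero_of_ae (.of_forall fun r ↦ ?_)
          simp only [Pi.zero_apply]
          by_cases hr : r ∈ Icc 0 T
          · rw [rlKernel_of_nonpos (by linarith [hr.1])]; simp
          · simp [dampedExtension, hr]
        rw [this]
  -- The damped Heaviside function is the kernel of order one, whose fractional integral is the
  -- primitive.
  have e₂ : convolution (rlKernel β 1) (rlKernel (1 - β) 1) (ContinuousLinearMap.lsmul ℝ ℝ)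
      volume = rlKernel 1 1 := by
    ext x
    rw [rlKernel_convolution_rlKernel hβ₀ hβ₁, rlKernel]
    simp
  rw [e₁, ← assoc, e₂, rlKernel_convolution_dampedExtension 1 1 f ht, smul_smul, ← exp_add]
  simp [rlIntegral]

/-- A Beta integral. It shows that the singular term `t^{α-1} y₀ / Γ(α)` carries the initial value
`y₀`. -/
theorem rlIntegral_one_div_rpow [CompleteSpace E] {α t : ℝ} (hα₀ : 0 < α) (hα₁ : α < 1) (ht : 0 < t) (c : E) :
    rlIntegral (1 - α) (fun τ ↦ (1 / τ ^ (1 - α)) • c) t = Gamma α • c := by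
  rw [rlIntegral]
  have h := integral_rpow_mul_rpow_sub_eq_Gamma hα₀ hα₁ ht
  have : ∫ τ in (0 : ℝ)..t, (1 / (t - τ) ^ (1 - (1 - α))) • (1 / τ ^ (1 - α)) • c =
      ∫ τ in (0 : ℝ)..t, (τ ^ (α - 1) * (t - τ) ^ (-α)) • c := by
    refine intervalIntegral.integral_congr fun τ hτ ↦ ?_
    rw [uIcc_of_le ht.le] at hτ
    simp only [smul_smul]
    rw [show α - 1 = -(1 - α) by ring, rpow_neg hτ.1, rpow_neg (sub_nonneg.2 hτ.2), sub_sub_cancel]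
    congr 1
    ring
  rw [this, intervalIntegral.integral_smul_const, h, smul_smul]
  have := (Gamma_pos_of_pos (sub_pos.2 hα₁)).ne'
  congr 1
  field_simp

theorem integrableOn_one_div_rpow_smul {α T : ℝ} (hα₀ : 0 < α) (c : E) :
    IntegrableOn (fun t : ℝ ↦ (1 / t ^ (1 - α)) • c) (Icc 0 T) := by
  rcases le_or_gt 0 T with hT | hT
  · refine Integrable.smul_const ?_ c
    have h := (intervalIntegral.intervalIntegrable_rpow' (a := 0) (b := T) (r := α - 1)
      (by linarith)).1
    rw [← integrableOn_Icc_iff_integrableOn_Ioc] at h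
    refine h.congr_fun (fun t ht ↦ ?_) measurableSet_Icc
    simp only
    rw [show α - 1 = -(1 - α) by ring, rpow_neg ht.1, one_div]
  · simp [Icc_eq_empty hT.not_ge]

end RLIntegral

/-! ### Gain of integrability from `L¹` to `L^p`. -/

section Lp

open Real
open scoped ENNReal

variable {E : Type*} [NormedAddCommGroup E] [NormedSpace ℝ E]

/-- Young's inequality `L^p ⋆ L¹ ⊆ L^p`, qualitative form. -/
theorem MeasureTheory.MemLp.convolution_integrable {k : ℝ → ℝ} {g : ℝ → E} {p : ℝ} (hp : 1 ≤ p)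
    (hk : MemLp k (ENNReal.ofReal p)) (hg : Integrable g) :
    MemLp (convolution k g (ContinuousLinearMap.lsmul ℝ ℝ) volume) (ENNReal.ofReal p) := by
  have hp₀ : 0 < p := by linarith
  have hmeas : AEStronglyMeasurable
      (convolution k g (ContinuousLinearMap.lsmul ℝ ℝ) volume) volume :=
    (hk.1.convolution_integrand (μ := volume) (ContinuousLinearMap.lsmul ℝ ℝ)
      hg.1).integral_prod_right'
  have hpt : (ENNReal.ofReal p).toReal = p := ENNReal.toReal_ofReal hp₀.le
  have hk_fin : ∫⁻ t, ‖k t‖ₑ ^ p < ∞ := by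
    have := lintegral_rpow_enorm_lt_top_of_eLpNorm_lt_top (by simpa using hp₀)
      ENNReal.ofReal_ne_top hk.2
    rwa [hpt] at this
  have hmul : ∀ t : ℝ, AEMeasurable (fun τ ↦ ‖k (t - τ)‖ₑ ^ p * ‖g τ‖ₑ) := fun t ↦
    (((hk.1.comp_quasiMeasurePreserving
      (quasiMeasurePreserving_sub_left_of_right_invariant volume t)).enorm.pow_const p)).mul
        hg.1.enorm
  have hpt_le : ∀ t, ‖convolution k g (ContinuousLinearMap.lsmul ℝ ℝ) volume t‖ₑ ^ p ≤
      (∫⁻ τ, ‖k (t - τ)‖ₑ ^ p * ‖g τ‖ₑ) * (∫⁻ τ, ‖g τ‖ₑ) ^ (p - 1) := by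
    intro t
    -- Hölder with exponents `p` and `p / (p - 1)`, after splitting `|k| |g| = (|k|^p |g|)^{1/p}
    -- |g|^{1-1/p}`.
    have h₁ : ‖convolution k g (ContinuousLinearMap.lsmul ℝ ℝ) volume t‖ₑ ≤
        ∫⁻ τ, (‖k (t - τ)‖ₑ ^ p * ‖g τ‖ₑ) ^ (1 / p) * ‖g τ‖ₑ ^ (1 - 1 / p) := by
      rw [convolution_eq_swap]
      refine (enorm_integral_le_lintegral_enorm _).trans (lintegral_mono fun τ ↦ ?_)
      have hq : 0 ≤ 1 - 1 / p := by
        rw [sub_nonneg, div_le_one hp₀]; exact hp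
      rw [ENNReal.mul_rpow_of_nonneg _ _ (by positivity), ← ENNReal.rpow_mul,
        mul_one_div_cancel hp₀.ne', ENNReal.rpow_one, mul_assoc,
        ← ENNReal.rpow_add_of_nonneg _ _ (by positivity) hq, add_sub_cancel, ENNReal.rpow_one]
      simp [enorm_smul]
    have h₂ := h₁.trans (ENNReal.lintegral_mul_norm_pow_le (hmul t) hg.1.enorm
      (by positivity) (by rw [sub_nonneg, div_le_one hp₀]; exact hp) (add_sub_cancel _ _))
    refine (ENNReal.rpow_le_rpow h₂ hp₀.le).trans_eq ?_
    rw [ENNReal.mul_rpow_of_nonneg _ _ hp₀.le, ← ENNReal.rpow_mul, ← ENNReal.rpow_mul,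
      one_div_mul_cancel hp₀.ne', ENNReal.rpow_one]
    congr 2
    field_simp
  refine ⟨hmeas, ?_⟩
  rw [eLpNorm_lt_top_iff_lintegral_rpow_enorm_lt_top (by simpa using hp₀) ENNReal.ofReal_ne_top,
    hpt]
  have hgfin : ∫⁻ τ, ‖g τ‖ₑ < ∞ := hg.2
  have hjoint : AEMeasurable (Function.uncurry fun t τ ↦ ‖k (t - τ)‖ₑ ^ p * ‖g τ‖ₑ)
      ((volume : Measure ℝ).prod volume) :=
    ((hk.1.comp_quasiMeasurePreserving
      (quasiMeasurePreserving_sub_of_right_invariant volume volume)).enorm.pow_const p).mul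
        hg.1.comp_snd.enorm
  -- Tonelli and translation invariance factor the remaining double integral.
  calc _ ≤ ∫⁻ t, (∫⁻ τ, ‖k (t - τ)‖ₑ ^ p * ‖g τ‖ₑ) * (∫⁻ τ, ‖g τ‖ₑ) ^ (p - 1) :=
        lintegral_mono hpt_le
    _ = ((∫⁻ t, ‖k t‖ₑ ^ p) * ∫⁻ τ, ‖g τ‖ₑ) * (∫⁻ τ, ‖g τ‖ₑ) ^ (p - 1) := by
      rw [lintegral_mul_const' _ _ (ENNReal.rpow_ne_top_of_nonneg (by linarith) hgfin.ne),
        lintegral_lintegral_swap hjoint]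
      congr 1
      rw [← lintegral_const_mul' _ _ hk_fin.ne]
      congr 1 with τ
      rw [lintegral_mul_const' _ _ enorm_ne_top,
        lintegral_sub_right_eq_self (fun t ↦ ‖k t‖ₑ ^ p) τ]
    _ < ∞ := ENNReal.mul_lt_top (ENNReal.mul_lt_top hk_fin hgfin)
        (ENNReal.rpow_lt_top_of_nonneg (by linarith) hgfin.ne)

/-- The `p`-th power of the kernel is a multiple of the kernel of order `p (β - 1) + 1` with damping
`s p`; that order is positive exactly when `p (1 - β) < 1`. -/
theorem memLp_rlKernel {β s p : ℝ} (hβ : 0 < β) (hs : 0 < s) (hp : 1 ≤ p)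
    (hpβ : p * (1 - β) < 1) : MemLp (rlKernel β s) (ENNReal.ofReal p) := by
  have hp₀ : 0 < p := by linarith
  have hγ : 0 < p * (β - 1) + 1 := by linarith
  rw [← integrable_norm_rpow_iff (measurable_rlKernel β s).aestronglyMeasurable
    (by simpa using hp₀) ENNReal.ofReal_ne_top, ENNReal.toReal_ofReal hp₀.le]
  refine ((integrable_rlKernel hγ (mul_pos hs hp₀)).const_mul
    ((1 / Gamma β) ^ p * Gamma (p * (β - 1) + 1))).congr (.of_forall fun t ↦ ?_)
  simp only
  rcases le_or_gt t 0 with ht | ht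
  · rw [rlKernel_of_nonpos ht, rlKernel_of_nonpos ht]
    simp [zero_rpow hp₀.ne']
  · rw [norm_of_nonneg (rlKernel_nonneg hβ s t), rlKernel_of_pos ht, rlKernel_of_pos ht,
      mul_rpow (by positivity) (by positivity), mul_rpow (by positivity) (by positivity),
      ← rpow_mul ht.le, ← exp_mul]
    have := (Gamma_pos_of_pos hγ).ne'
    rw [show (β - 1) * p = p * (β - 1) + 1 - 1 by ring,
      show -(s * t) * p = -(s * p * t) by ring]
    field_simp

/-- Undoes the damping at the cost of a factor `e^T`. -/
theorem memLp_exp_smul {T p : ℝ} {g : ℝ → E} (hg : MemLp g (ENNReal.ofReal p)) :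
    MemLp (fun t ↦ exp (1 * t) • g t) (ENNReal.ofReal p) (volume.restrict (Icc 0 T)) := by
  have hr := hg.restrict (Icc 0 T)
  refine hr.of_le_mul (c := exp T) ?_ ?_
  · exact (Continuous.aestronglyMeasurable (by fun_prop)).smul hr.1
  · filter_upwards [ae_restrict_mem measurableSet_Icc] with t ht
    rw [norm_smul, norm_of_nonneg (exp_pos _).le, one_mul]
    exact mul_le_mul_of_nonneg_right (exp_le_exp.2 ht.2) (norm_nonneg _)

/-- The fractional integral of order `β` maps `L¹` to `L^p` for `p < 1 / (1 - β)`. -/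
theorem memLp_rlIntegral {β p T : ℝ} (hβ : 0 < β) (hp : 1 ≤ p) (hpβ : p * (1 - β) < 1)
    {f : ℝ → E} (hf : IntegrableOn f (Icc 0 T)) :
    MemLp (rlIntegral β f) (ENNReal.ofReal p) (volume.restrict (Icc 0 T)) := by
  refine (memLp_exp_smul ((memLp_rlKernel hβ one_pos hp hpβ).convolution_integrable hp
    (integrable_dampedExtension (s := 1) hf))).ae_eq ?_
  filter_upwards [ae_restrict_mem measurableSet_Icc] with t ht
  exact (rlIntegral_eq_smul_convolution β 1 f ht).symm

theorem memLp_one_div_rpow_smul {α p T : ℝ} (hα : 0 < α) (hp : 1 ≤ p) (hpα : p * (1 - α) < 1)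
    (c : E) : MemLp (fun t : ℝ ↦ (1 / t ^ (1 - α)) • c) (ENNReal.ofReal p)
      (volume.restrict (Icc 0 T)) := by
  have h := (memLp_exp_smul (T := T) (memLp_rlKernel hα one_pos hp hpα)).const_mul (Gamma α)
  have h₀ : ∀ᵐ t : ℝ ∂volume.restrict (Icc 0 T), t ≠ 0 :=
    ae_restrict_of_ae (by simp [ae_iff, measure_singleton])
  have hs : MemLp (fun t : ℝ ↦ 1 / t ^ (1 - α)) (ENNReal.ofReal p)
      (volume.restrict (Icc 0 T)) := by
    refine h.ae_eq ?_
    filter_upwards [ae_restrict_mem measurableSet_Icc, h₀] with t ht h₀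
    have ht₀ : 0 < t := lt_of_le_of_ne ht.1 h₀.symm
    have := (Gamma_pos_of_pos hα).ne'
    rw [rlKernel_of_pos ht₀, show α - 1 = -(1 - α) by ring, rpow_neg ht.1, smul_eq_mul, exp_neg]
    field_simp
  refine hs.of_le_mul (c := ‖c‖) (hs.1.smul_const c) (.of_forall fun t ↦ ?_)
  rw [norm_smul, mul_comm]

end Lp

/-! ### The initial value problem as an integral equation. -/

section Representation

open Real

variable {E : Type*} [NormedAddCommGroup E] [NormedSpace ℝ E] [CompleteSpace E]

/-- Identifies the absolutely continuous representative of `I^{1-α}` of a solution; both directions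
of the equivalence rest on it. -/
theorem rlIntegral_rlIntegral_add_ae {α T : ℝ} (hα₀ : 0 < α) (hα₁ : α < 1) {v : ℝ → E}
    (hv : IntegrableOn v (Icc 0 T)) (y₀ : E) :
    ∀ᵐ t ∂volume.restrict (Icc 0 T), rlIntegral (1 - α)
      (fun τ ↦ rlIntegral α v τ + (1 / τ ^ (1 - α)) • (1 / Gamma α) • y₀) t =
        y₀ + ∫ τ in (0 : ℝ)..t, v τ := by
  have h₁ := rlIntegral_linear_ae (sub_pos.2 hα₁) (integrableOn_rlIntegral hα₀ hv)
    (integrableOn_one_div_rpow_smul (T := T) hα₀ ((1 / Gamma α) • y₀)) 1 1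
  have h₂ := rlIntegral_rlIntegral_ae (sub_pos.2 hα₁) (by linarith) hv
  have h₀ : ∀ᵐ t : ℝ ∂volume.restrict (Icc 0 T), t ≠ 0 :=
    ae_restrict_of_ae (by simp [ae_iff, measure_singleton])
  rw [sub_sub_cancel] at h₂
  simp only [one_smul] at h₁
  filter_upwards [h₁, h₂, h₀, ae_restrict_mem measurableSet_Icc] with t h₁ h₂ h₀ ht
  rw [h₁, h₂, rlIntegral_one_div_rpow hα₀ hα₁ (lt_of_le_of_ne ht.1 h₀.symm), smul_smul,
    mul_one_div_cancel (Gamma_pos_of_pos hα₀).ne', one_smul, add_comm]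

/-- An integrable function whose primitive vanishes a.e. is zero a.e. -/
theorem ae_eq_zero_of_ae_integral_eq_zero {T : ℝ} (hT : 0 < T) {f : ℝ → E}
    (hf : IntegrableOn f (Icc 0 T))
    (h : ∀ᵐ t ∂volume.restrict (Icc 0 T), ∫ τ in (0 : ℝ)..t, f τ = 0) :
    ∀ᵐ t ∂volume.restrict (Icc 0 T), f t = 0 := by
  have hi : IntervalIntegrable f volume 0 T :=
    (intervalIntegrable_iff_integrableOn_Icc_of_le hT.le).2 hf
  -- Continuity of the primitive upgrades a.e. vanishing to vanishing on all of `[0,T]`, so its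
  -- derivative, a.e. equal to `f`, is zero.
  have heq : EqOn (fun t ↦ ∫ τ in (0 : ℝ)..t, f τ) (fun _ ↦ 0) (Icc 0 T) := by
    refine Measure.eqOn_Icc_of_ae_eq volume hT.ne h ?_ continuousOn_const
    have := intervalIntegral.continuousOn_primitive_interval (μ := volume) (f := f) (a := 0)
      (b := T) (by rwa [uIcc_of_le hT.le])
    rwa [uIcc_of_le hT.le] at this
  rw [ae_restrict_iff' measurableSet_Icc]
  have h₀ : ∀ᵐ t : ℝ, t ≠ 0 := by simp [ae_iff, measure_singleton]
  have h₁ : ∀ᵐ t : ℝ, t ≠ T := by simp [ae_iff, measure_singleton]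
  filter_upwards [hi.ae_hasDerivAt_integral, h₀, h₁] with t hd h₀ h₁ ht
  rw [uIcc_of_le hT.le] at hd
  have hmem : Icc 0 T ∈ nhds t :=
    Icc_mem_nhds (lt_of_le_of_ne ht.1 h₀.symm) (lt_of_le_of_ne ht.2 h₁)
  exact (hd ht 0 ⟨le_rfl, hT.le⟩).unique
    ((hasDerivAt_const t (0 : E)).congr_of_eventuallyEq (heq.eventuallyEq_of_mem hmem))

/-- The fractional integral is injective on `L¹`. -/
theorem ae_eq_of_rlIntegral_ae_eq {β T : ℝ} (hβ₀ : 0 < β) (hβ₁ : β < 1) (hT : 0 < T)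
    {f g : ℝ → E} (hf : IntegrableOn f (Icc 0 T)) (hg : IntegrableOn g (Icc 0 T))
    (h : ∀ᵐ t ∂volume.restrict (Icc 0 T), rlIntegral β f t = rlIntegral β g t) :
    ∀ᵐ t ∂volume.restrict (Icc 0 T), f t = g t := by
  have hD : IntegrableOn (fun t ↦ (1 : ℝ) • f t + (-1 : ℝ) • g t) (Icc 0 T) :=
    (hf.smul (1 : ℝ)).add (hg.smul (-1 : ℝ))
  have h₁ : ∀ᵐ t ∂volume.restrict (Icc 0 T),
      rlIntegral β (fun t ↦ (1 : ℝ) • f t + (-1 : ℝ) • g t) t = 0 := by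
    filter_upwards [h, rlIntegral_linear_ae hβ₀ hf hg 1 (-1)] with t h₁ h₂
    rw [h₂, h₁]; simp
  -- Applying the integral of complementary order turns `I^β` of the difference into its primitive.
  have h₂ := rlIntegral_rlIntegral_ae (sub_pos.2 hβ₁) (by linarith) hD
  rw [sub_sub_cancel] at h₂
  have h₃ := ae_eq_zero_of_ae_integral_eq_zero hT hD (by
    filter_upwards [h₂, ae_restrict_mem measurableSet_Icc] with t h₂ ht
    rw [← h₂, rlIntegral_congr_ae (1 - β) h₁ t ht]
    simp [rlIntegral])
  filter_upwards [h₃] with t h₃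
  rw [one_smul, neg_one_smul, ← sub_eq_add_neg] at h₃
  exact sub_eq_zero.1 h₃

/-- The initial value problem for the Riemann–Liouville derivative is equivalent to an integral
equation. -/
theorem hasRLDerivWithInit_iff {α T : ℝ} (hα₀ : 0 < α) (hα₁ : α < 1) (hT : 0 < T)
    {f v : ℝ → E} (hv : IntegrableOn v (Icc 0 T)) (y₀ : E) :
    HasRLDerivWithInit α T f v y₀ ↔ IntegrableOn f (Icc 0 T) ∧
      ∀ᵐ t ∂volume.restrict (Icc 0 T),
        f t = rlIntegral α v t + (1 / t ^ (1 - α)) • (1 / Gamma α) • y₀ := by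
  have hi : IntervalIntegrable v volume 0 T :=
    (intervalIntegrable_iff_integrableOn_Icc_of_le hT.le).2 hv
  have hmild := rlIntegral_rlIntegral_add_ae hα₀ hα₁ hv y₀
  constructor
  · rintro ⟨hf, F, hF, hFf, hFv, hF₀⟩
    -- By injectivity it is enough to compare `I^{1-α}` of both sides; each equals `y₀ + ∫ v`.
    refine ⟨hf, ae_eq_of_rlIntegral_ae_eq (sub_pos.2 hα₁) (by linarith) hT hf
      ((integrableOn_rlIntegral hα₀ hv).add (integrableOn_one_div_rpow_smul hα₀ _)) ?_⟩
    have hprim := hF.eq_add_integral hi (by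
      rw [uIcc_of_le hT.le]
      exact (ae_restrict_iff' measurableSet_Icc).1 hFv)
    rw [uIcc_of_le hT.le, hF₀] at hprim
    filter_upwards [hFf, hmild, ae_restrict_mem measurableSet_Icc] with t h₁ h₂ ht
    rw [← h₁, h₂, hprim t ht]
  · rintro ⟨hf, h⟩
    refine ⟨hf, fun t ↦ y₀ + ∫ τ in (0 : ℝ)..t, v τ, ?_, ?_, ?_, by simp⟩
    · exact ((LipschitzWith.const y₀).lipschitzOnWith.absolutelyContinuousOnInterval).add
        (hi.absolutelyContinuousOnInterval_primitive (by simp))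
    · filter_upwards [hmild, ae_restrict_mem measurableSet_Icc] with t h₁ ht
      rw [rlIntegral_congr_ae (1 - α) h t ht, h₁]
    · rw [ae_restrict_iff' measurableSet_Icc]
      filter_upwards [hi.ae_hasDerivAt_integral] with t hd ht
      rw [uIcc_of_le hT.le] at hd
      exact (hd ht 0 ⟨le_rfl, hT.le⟩).const_add y₀

end Representation

/-! ### Linear fractional Volterra equations in weighted `L¹`. -/

section Volterra

open Real

theorem integrableOn_exp_mul_norm {E : Type*} [NormedAddCommGroup E] {T : ℝ} (s : ℝ) {f : ℝ → E}
    (hf : IntegrableOn f (Icc 0 T)) :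
    IntegrableOn (fun t ↦ exp (-(s * t)) * ‖f t‖) (Icc 0 T) :=
  IntegrableOn.continuousOn_smul (f := fun t ↦ exp (-(s * t))) hf.norm (by fun_prop) isCompact_Icc

variable {E : Type*} [NormedAddCommGroup E] [NormedSpace ℝ E]

/-- The choice is `s^α = 2 (M + 1)`; with `M = ‖A‖` it makes `I^α ∘ A` a contraction in the norm
weighted by `e^{-st}`. -/
theorem exists_one_div_rpow_mul_le {α : ℝ} (hα : 0 < α) {M : ℝ} (hM : 0 ≤ M) :
    ∃ s : ℝ, 0 < s ∧ (1 / s) ^ α * M ≤ 1 / 2 ∧ (1 / s) ^ α ≤ 1 / 2 := by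
  refine ⟨(2 * (M + 1)) ^ (1 / α), by positivity, ?_⟩
  have e : (1 / (2 * (M + 1)) ^ (1 / α)) ^ α = 1 / (2 * (M + 1)) := by
    rw [one_div, inv_rpow (by positivity), ← rpow_mul (by positivity), one_div_mul_cancel hα.ne',
      rpow_one, one_div]
  rw [e]
  constructor
  · rw [one_div_mul_eq_div, div_le_div_iff₀ (by positivity) two_pos]; linarith
  · exact one_div_le_one_div_of_le two_pos (by linarith)

/-- Solutions of the linear fractional Volterra equation depend continuously on the forcing term,
in `L¹`. -/
theorem exists_volterra_stability {α T : ℝ} (hα : 0 < α) (A : E →L[ℝ] E) :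
    ∃ C : ℝ, ∀ x₁ x₂ w₁ w₂ h : ℝ → E, IntegrableOn x₁ (Icc 0 T) → IntegrableOn x₂ (Icc 0 T) →
      IntegrableOn w₁ (Icc 0 T) → IntegrableOn w₂ (Icc 0 T) →
      (∀ᵐ t ∂volume.restrict (Icc 0 T), x₁ t = rlIntegral α (fun τ ↦ A (x₁ τ) + w₁ τ) t + h t) →
      (∀ᵐ t ∂volume.restrict (Icc 0 T), x₂ t = rlIntegral α (fun τ ↦ A (x₂ τ) + w₂ τ) t + h t) →
      ∫ t in Icc 0 T, ‖x₁ t - x₂ t‖ ≤ C * ∫ t in Icc 0 T, ‖w₁ t - w₂ t‖ := by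
  obtain ⟨s, hs, hsA, hs1⟩ := exists_one_div_rpow_mul_le hα (norm_nonneg A)
  -- The weight lies between `e^{-sT}` and `1` on `[0,T]`; this is the price of removing it.
  refine ⟨exp (s * T), fun x₁ x₂ w₁ w₂ h hx₁ hx₂ hw₁ hw₂ h₁ h₂ ↦ ?_⟩
  have hg₁ : IntegrableOn (fun τ ↦ A (x₁ τ) + w₁ τ) (Icc 0 T) := (A.integrable_comp hx₁).add hw₁
  have hg₂ : IntegrableOn (fun τ ↦ A (x₂ τ) + w₂ τ) (Icc 0 T) := (A.integrable_comp hx₂).add hw₂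
  have hx : IntegrableOn (fun t ↦ x₁ t - x₂ t) (Icc 0 T) := hx₁.sub hx₂
  have hw : IntegrableOn (fun t ↦ w₁ t - w₂ t) (Icc 0 T) := hw₁.sub hw₂
  have hg : IntegrableOn (fun τ ↦ A (x₁ τ - x₂ τ) + (w₁ τ - w₂ τ)) (Icc 0 T) :=
    (A.integrable_comp hx).add hw
  have hdiff : ∀ᵐ t ∂volume.restrict (Icc 0 T), x₁ t - x₂ t =
      rlIntegral α (fun τ ↦ A (x₁ τ - x₂ τ) + (w₁ τ - w₂ τ)) t := by
    filter_upwards [h₁, h₂, rlIntegral_linear_ae hα hg₁ hg₂ 1 (-1)] with t h₁ h₂ h₃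
    have e : (fun τ ↦ A (x₁ τ - x₂ τ) + (w₁ τ - w₂ τ)) =
        fun τ ↦ (1 : ℝ) • (A (x₁ τ) + w₁ τ) + (-1 : ℝ) • (A (x₂ τ) + w₂ τ) := by
      ext τ; rw [map_sub, one_smul, neg_one_smul]; abel
    rw [e, h₃, h₁, h₂, one_smul, neg_one_smul]; abel
  -- For the weighted norms `X` of `x₁ - x₂` and `W` of `w₁ - w₂`, the choice of `s` gives `X ≤ X /
  -- 2 + W / 2`.
  have key : ∫ t in Icc 0 T, exp (-(s * t)) * ‖x₁ t - x₂ t‖ ≤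
      ∫ t in Icc 0 T, exp (-(s * t)) * ‖w₁ t - w₂ t‖ := by
    have b₁ : ∫ t in Icc 0 T, exp (-(s * t)) * ‖x₁ t - x₂ t‖ ≤ (1 / s) ^ α *
        ∫ t in Icc 0 T, exp (-(s * t)) * ‖A (x₁ t - x₂ t) + (w₁ t - w₂ t)‖ := by
      refine le_trans (le_of_eq (integral_congr_ae ?_))
        (integral_exp_mul_norm_rlIntegral_le hα hs hg)
      filter_upwards [hdiff] with t ht
      rw [← ht]
    have b₂ : ∫ t in Icc 0 T, exp (-(s * t)) * ‖A (x₁ t - x₂ t) + (w₁ t - w₂ t)‖ ≤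
        ‖A‖ * (∫ t in Icc 0 T, exp (-(s * t)) * ‖x₁ t - x₂ t‖) +
          ∫ t in Icc 0 T, exp (-(s * t)) * ‖w₁ t - w₂ t‖ := by
      rw [← integral_const_mul, ← integral_add
        ((integrableOn_exp_mul_norm s hx).const_mul _) (integrableOn_exp_mul_norm s hw)]
      refine integral_mono (integrableOn_exp_mul_norm s hg)
        (((integrableOn_exp_mul_norm s hx).const_mul _).add (integrableOn_exp_mul_norm s hw))
        fun t ↦ ?_
      have := (norm_add_le (A (x₁ t - x₂ t)) (w₁ t - w₂ t)).trans
        (add_le_add_left (A.le_opNorm _) _)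
      calc _ ≤ exp (-(s * t)) * (‖A‖ * ‖x₁ t - x₂ t‖ + ‖w₁ t - w₂ t‖) := by gcongr
        _ = _ := by ring
    have n₁ : 0 ≤ ∫ t in Icc 0 T, exp (-(s * t)) * ‖x₁ t - x₂ t‖ :=
      integral_nonneg fun t ↦ by positivity
    have n₂ : 0 ≤ ∫ t in Icc 0 T, exp (-(s * t)) * ‖w₁ t - w₂ t‖ :=
      integral_nonneg fun t ↦ by positivity
    have b₃ := b₁.trans (mul_le_mul_of_nonneg_left b₂ (by positivity))
    rw [mul_add, ← mul_assoc] at b₃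
    have b₄ := mul_le_mul_of_nonneg_right hsA n₁
    have b₅ := mul_le_mul_of_nonneg_right hs1 n₂
    linarith
  have low : exp (-(s * T)) * ∫ t in Icc 0 T, ‖x₁ t - x₂ t‖ ≤
      ∫ t in Icc 0 T, exp (-(s * t)) * ‖x₁ t - x₂ t‖ := by
    rw [← integral_const_mul]
    refine setIntegral_mono_on (hx.norm.const_mul _) (integrableOn_exp_mul_norm s hx)
      measurableSet_Icc fun t ht ↦ ?_
    gcongr
    exact ht.2
  have high : ∫ t in Icc 0 T, exp (-(s * t)) * ‖w₁ t - w₂ t‖ ≤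
      ∫ t in Icc 0 T, ‖w₁ t - w₂ t‖ := by
    refine setIntegral_mono_on (integrableOn_exp_mul_norm s hw) hw.norm
      measurableSet_Icc fun t ht ↦ ?_
    refine mul_le_of_le_one_left (norm_nonneg _) (exp_le_one_iff.2 ?_)
    have := mul_nonneg hs.le ht.1
    linarith
  have := mul_le_mul_of_nonneg_left (low.trans (key.trans high)) (exp_pos (s * T)).le
  rwa [← mul_assoc, ← exp_add, add_neg_cancel, exp_zero, one_mul] at this

/-- The linear fractional Volterra equation has an `L¹` solution. -/
theorem exists_volterra_solution [CompleteSpace E] {α T : ℝ} (hα : 0 < α) (A : E →L[ℝ] E)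
    {w h : ℝ → E} (hw : IntegrableOn w (Icc 0 T)) (hh : IntegrableOn h (Icc 0 T)) :
    ∃ x : ℝ → E, IntegrableOn x (Icc 0 T) ∧
      ∀ᵐ t ∂volume.restrict (Icc 0 T), x t = rlIntegral α (fun τ ↦ A (x τ) + w τ) t + h t := by
  obtain ⟨s, hs, hsA, -⟩ := exists_one_div_rpow_mul_le hα (norm_nonneg A)
  set μ := volume.restrict (Icc (0 : ℝ) T)
  have smul_exp : ∀ (r : ℝ) {f : ℝ → E}, IntegrableOn f (Icc 0 T) →
      IntegrableOn (fun t ↦ exp (r * t) • f t) (Icc 0 T) := fun r f hf ↦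
    hf.continuousOn_smul (by fun_prop) isCompact_Icc
  have hz : ∀ z : Lp E 1 μ, IntegrableOn (fun t ↦ exp (s * t) • z t) (Icc 0 T) := fun z ↦
    smul_exp s (L1.integrable_coeFn z)
  have hg : ∀ z : Lp E 1 μ, IntegrableOn (fun t ↦ A (exp (s * t) • z t) + w t) (Icc 0 T) :=
    fun z ↦ (A.integrable_comp (hz z)).add hw
  -- The unknown is `z = e^{-st} x`, so that the ordinary `L¹` norm of `z` is the weighted norm of
  -- `x`.
  let ψ : Lp E 1 μ → ℝ → E := fun z t ↦
    exp (-s * t) • (rlIntegral α (fun τ ↦ A (exp (s * τ) • z τ) + w τ) t + h t)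
  have hψ : ∀ z, Integrable (ψ z) μ := fun z ↦
    smul_exp (-s) ((integrableOn_rlIntegral hα (hg z)).add hh)
  let Φ : Lp E 1 μ → Lp E 1 μ := fun z ↦ (hψ z).toL1
  have hΦ : ContractingWith (1 / 2) Φ := by
    refine ⟨by rw [← NNReal.coe_lt_coe]; norm_num, LipschitzWith.of_dist_le_mul fun z₁ z₂ ↦ ?_⟩
    have hd : Integrable (fun t ↦ z₁ t - z₂ t) μ :=
      (L1.integrable_coeFn z₁).sub (L1.integrable_coeFn z₂)
    have hA : IntegrableOn (fun t ↦ A (exp (s * t) • (z₁ t - z₂ t))) (Icc 0 T) :=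
      A.integrable_comp (smul_exp s hd)
    have e₁ : dist (Φ z₁) (Φ z₂) = ∫ t in Icc 0 T, exp (-(s * t)) *
        ‖rlIntegral α (fun τ ↦ A (exp (s * τ) • (z₁ τ - z₂ τ))) t‖ := by
      rw [L1.dist_eq_integral_dist]
      refine integral_congr_ae ?_
      filter_upwards [(hψ z₁).coeFn_toL1, (hψ z₂).coeFn_toL1,
        rlIntegral_linear_ae hα (hg z₁) (hg z₂) 1 (-1)] with t h₁ h₂ h₃
      have e : (fun τ ↦ A (exp (s * τ) • (z₁ τ - z₂ τ))) =
          fun τ ↦ (1 : ℝ) • (A (exp (s * τ) • z₁ τ) + w τ) +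
            (-1 : ℝ) • (A (exp (s * τ) • z₂ τ) + w τ) := by
        ext τ; rw [smul_sub, map_sub, one_smul, neg_one_smul]; abel
      rw [e, h₃, h₁, h₂, dist_eq_norm, ← smul_sub, norm_smul, norm_of_nonneg (exp_pos _).le,
        one_smul, neg_one_smul, add_sub_add_right_eq_sub, ← sub_eq_add_neg, neg_mul]
    rw [e₁, L1.dist_eq_integral_dist]
    refine (integral_exp_mul_norm_rlIntegral_le hα hs hA).trans ?_
    have e₂ : ∫ t in Icc 0 T, exp (-(s * t)) * ‖A (exp (s * t) • (z₁ t - z₂ t))‖ ≤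
        ‖A‖ * ∫ t in Icc 0 T, dist (z₁ t) (z₂ t) := by
      rw [← integral_const_mul]
      refine integral_mono (integrableOn_exp_mul_norm s hA) ?_ fun t ↦ ?_
      · simp only [dist_eq_norm]
        exact hd.norm.const_mul _
      · simp only
        rw [map_smul, norm_smul, norm_of_nonneg (exp_pos _).le, ← mul_assoc, ← exp_add,
          neg_add_cancel, exp_zero, one_mul, dist_eq_norm]
        exact A.le_opNorm _
    have n : 0 ≤ ∫ t in Icc 0 T, dist (z₁ t) (z₂ t) := integral_nonneg fun t ↦ dist_nonneg
    calc _ ≤ (1 / s) ^ α * (‖A‖ * ∫ t in Icc 0 T, dist (z₁ t) (z₂ t)) := by gcongr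
      _ = ((1 / s) ^ α * ‖A‖) * ∫ t in Icc 0 T, dist (z₁ t) (z₂ t) := by ring
      _ ≤ _ := by
        refine (mul_le_mul_of_nonneg_right hsA n).trans_eq ?_
        simp [μ]
  let z := ContractingWith.fixedPoint Φ hΦ
  have hfix : Φ z = z := hΦ.fixedPoint_isFixedPt
  refine ⟨fun t ↦ exp (s * t) • z t, hz z, ?_⟩
  have := (hψ z).coeFn_toL1
  rw [show (hψ z).toL1 = z from hfix] at this
  filter_upwards [this] with t ht
  have e : ψ z t = exp (-s * t) •
    (rlIntegral α (fun τ ↦ A (exp (s * τ) • z τ) + w τ) t + h t) := rfl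
  conv_lhs => rw [ht, e]
  rw [smul_smul, ← exp_add]
  simp

end Volterra

/-! ### Convergence in `L¹` for functions rather than classes. -/

section L1Sequences

open Filter
open scoped Topology ENNReal

variable {X E : Type*} [MeasurableSpace X] {μ : Measure X} [NormedAddCommGroup E]

theorem exists_integrable_tendsto_of_cauchy [CompleteSpace E] {f : ℕ → X → E}
    (hf : ∀ n, Integrable (f n) μ)
    (hc : ∀ ρ > 0, ∃ n₀, ∀ n ≥ n₀, ∀ k ≥ n₀, ∫ t, ‖f n t - f k t‖ ∂μ < ρ) :
    ∃ g : X → E, Integrable g μ ∧ Tendsto (fun n ↦ ∫ t, ‖f n t - g t‖ ∂μ) atTop (𝓝 0) := by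
  have hcs : CauchySeq fun n ↦ (hf n).toL1 := by
    refine Metric.cauchySeq_iff.2 fun ρ hρ ↦ ?_
    obtain ⟨n₀, h⟩ := hc ρ hρ
    refine ⟨n₀, fun n hn k hk ↦ lt_of_eq_of_lt ?_ (h n hn k hk)⟩
    rw [L1.dist_eq_integral_dist]
    refine integral_congr_ae ?_
    filter_upwards [(hf n).coeFn_toL1, (hf k).coeFn_toL1] with t h₁ h₂
    rw [h₁, h₂, dist_eq_norm]
  obtain ⟨g, hg⟩ := cauchySeq_tendsto_of_complete hcs
  refine ⟨g, L1.integrable_coeFn g, (tendsto_iff_dist_tendsto_zero.1 hg).congr fun n ↦ ?_⟩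
  rw [L1.dist_eq_integral_dist]
  refine integral_congr_ae ?_
  filter_upwards [(hf n).coeFn_toL1] with t h₁
  rw [h₁, dist_eq_norm]

/-- Convergence in `L¹` implies convergence in measure, hence a.e. convergence of a subsequence. -/
theorem exists_subseq_tendsto_ae_of_integral_norm {f : ℕ → X → E} {g : X → E}
    (hf : ∀ n, Integrable (f n) μ) (hg : Integrable g μ)
    (h : Tendsto (fun n ↦ ∫ t, ‖f n t - g t‖ ∂μ) atTop (𝓝 0)) :
    ∃ ns : ℕ → ℕ, StrictMono ns ∧ ∀ᵐ t ∂μ, Tendsto (fun i ↦ f (ns i) t) atTop (𝓝 (g t)) := by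
  refine (tendstoInMeasure_of_tendsto_eLpNorm (p := 1) one_ne_zero (fun n ↦ (hf n).1) hg.1
    ?_).exists_seq_tendsto_ae
  have := ENNReal.tendsto_ofReal h
  rw [ENNReal.ofReal_zero] at this
  refine this.congr fun n ↦ ?_
  rw [eLpNorm_one_eq_lintegral_enorm]
  exact ofReal_integral_norm_eq_lintegral_enorm ((hf n).sub hg)

end L1Sequences

/-! ### Linearity of the dynamics and convexity of the running cost. -/

namespace HegselmannKrause

open Real

variable {N d : ℕ}

/-- The right-hand side of the system is linear in the state and the control. -/
theorem exists_field_eq (a : Fin N → Fin N → ℝ) (c : Fin N → ℝ) :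
    ∃ (A : State N d →L[ℝ] State N d) (B : EuclideanSpace ℝ (Fin d) →L[ℝ] State N d),
      ∀ x u, field a c x u = A x + B u := by
  let A : State N d →ₗ[ℝ] State N d :=
    { toFun := fun x ↦ field a c x 0
      map_add' := fun x y ↦ by
        ext i : 1
        refine Fin.cases ?_ (fun i ↦ ?_) i
        · simp [field]
        · simp only [field, Fin.cons_succ, Pi.add_apply, add_sub_add_comm, smul_add,
            Finset.sum_add_distrib]
          abel
      map_smul' := fun r x ↦ by
        ext i : 1
        refine Fin.cases ?_ (fun i ↦ ?_) i
        · simp [field]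
        · simp only [field, Fin.cons_succ, Pi.smul_apply, ← smul_sub, smul_comm _ r,
            ← Finset.smul_sum, RingHom.id_apply, smul_add] }
  let B : EuclideanSpace ℝ (Fin d) →ₗ[ℝ] State N d := 
    LinearMap.single ℝ (fun _ : Fin (N + 1) ↦ EuclideanSpace ℝ (Fin d)) 0
  refine ⟨LinearMap.toContinuousLinearMap A, LinearMap.toContinuousLinearMap B, fun x u ↦ ?_⟩
  ext i : 1
  refine Fin.cases ?_ (fun i ↦ ?_) i <;> simp [A, B, field]

theorem runningCost_nonneg {ν : ℝ} (hν : 0 ≤ ν) (x : State N d)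
    (u : EuclideanSpace ℝ (Fin d)) : 0 ≤ runningCost ν x u := by
  unfold runningCost
  positivity

theorem continuous_runningCost (ν : ℝ) :
    Continuous fun z : State N d × EuclideanSpace ℝ (Fin d) ↦ runningCost ν z.1 z.2 := by
  unfold runningCost
  fun_prop

theorem aemeasurable_runningCost {T ν : ℝ} {x : ℝ → State N d}
    {u : ℝ → EuclideanSpace ℝ (Fin d)} (hx : IntegrableOn x (Icc 0 T))
    (hu : IntegrableOn u (Icc 0 T)) :
    AEMeasurable (fun t ↦ ENNReal.ofReal (runningCost ν (x t) (u t)))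
      (volume.restrict (Icc 0 T)) :=
  ((continuous_runningCost ν).comp_aestronglyMeasurable
    (hx.1.prodMk hu.1)).aemeasurable.ennreal_ofReal

/-- The parallelogram identity; the term `‖p - q‖² / 4` is the convexity gain that controls
distances between controls. -/
theorem norm_midpoint_sq {V : Type*} [NormedAddCommGroup V] [InnerProductSpace ℝ V] (p q : V) :
    ‖(1 / 2 : ℝ) • p + (1 / 2 : ℝ) • q‖ ^ 2 + 1 / 4 * ‖p - q‖ ^ 2 =
      1 / 2 * ‖p‖ ^ 2 + 1 / 2 * ‖q‖ ^ 2 := by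
  rw [norm_add_sq_real, norm_sub_sq_real, norm_smul, norm_smul, real_inner_smul_left,
    real_inner_smul_right]
  norm_num
  ring

/-- Uniform convexity of the running cost in the control. -/
theorem runningCost_midpoint_le {ν : ℝ} (x y : State N d) (u v : EuclideanSpace ℝ (Fin d)) :
    2 * runningCost ν ((1 / 2 : ℝ) • x + (1 / 2 : ℝ) • y) ((1 / 2 : ℝ) • u + (1 / 2 : ℝ) • v) +
      ν / 4 * ‖u - v‖ ^ 2 ≤ runningCost ν x u + runningCost ν y v := by
  have hle : ∀ i j : Fin (N + 1), ‖((1 / 2 : ℝ) • x + (1 / 2 : ℝ) • y) i -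
      ((1 / 2 : ℝ) • x + (1 / 2 : ℝ) • y) j‖ ^ 2 ≤
        1 / 2 * ‖x i - x j‖ ^ 2 + 1 / 2 * ‖y i - y j‖ ^ 2 := fun i j ↦ by
    have e : ((1 / 2 : ℝ) • x + (1 / 2 : ℝ) • y) i - ((1 / 2 : ℝ) • x + (1 / 2 : ℝ) • y) j =
        (1 / 2 : ℝ) • (x i - x j) + (1 / 2 : ℝ) • (y i - y j) := by
      simp only [Pi.add_apply, Pi.smul_apply, smul_sub]; abel
    rw [e, ← norm_midpoint_sq]
    -- The gain is discarded in the state terms and kept only in the control term.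
    have : 0 ≤ 1 / 4 * ‖x i - x j - (y i - y j)‖ ^ 2 := by positivity
    linarith
  have h₁ : 1 / (2 * (N : ℝ) ^ 2) * ∑ i : Fin N, ∑ j : Fin N,
      ‖((1 / 2 : ℝ) • x + (1 / 2 : ℝ) • y) i.succ - ((1 / 2 : ℝ) • x + (1 / 2 : ℝ) • y) j.succ‖ ^ 2
      ≤ 1 / (2 * (N : ℝ) ^ 2) * ∑ i : Fin N, ∑ j : Fin N,
        (1 / 2 * ‖x i.succ - x j.succ‖ ^ 2 + 1 / 2 * ‖y i.succ - y j.succ‖ ^ 2) :=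
    mul_le_mul_of_nonneg_left
      (Finset.sum_le_sum fun i _ ↦ Finset.sum_le_sum fun j _ ↦ hle _ _) (by positivity)
  have h₂ : 1 / 2 * ∑ i : Fin N,
      ‖((1 / 2 : ℝ) • x + (1 / 2 : ℝ) • y) 0 - ((1 / 2 : ℝ) • x + (1 / 2 : ℝ) • y) i.succ‖ ^ 2
      ≤ 1 / 2 * ∑ i : Fin N,
        (1 / 2 * ‖x 0 - x i.succ‖ ^ 2 + 1 / 2 * ‖y 0 - y i.succ‖ ^ 2) :=
    mul_le_mul_of_nonneg_left (Finset.sum_le_sum fun i _ ↦ hle _ _) (by norm_num)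
  have h₃ := norm_midpoint_sq u v
  simp only [Finset.sum_add_distrib, ← Finset.mul_sum] at h₁ h₂
  unfold runningCost
  linear_combination 2 * h₁ + 2 * h₂ + ν * h₃

/-! ### Admissible pairs and existence of a minimizer. -/

section Admissible

variable {α K T ν : ℝ} {a : Fin N → Fin N → ℝ} {c : Fin N → ℝ} {x₀ : State N d}
  {x y : ℝ → State N d} {u v : ℝ → EuclideanSpace ℝ (Fin d)}

theorem integrableOn_field (hx : IntegrableOn x (Icc 0 T)) (hu : IntegrableOn u (Icc 0 T)) :
    IntegrableOn (fun t ↦ field a c (x t) (u t)) (Icc 0 T) := by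
  obtain ⟨A, B, hAB⟩ := exists_field_eq (d := d) a c
  simp only [hAB]
  exact (A.integrable_comp hx).add (B.integrable_comp hu)

/-- Admissibility in terms of the integral equation. -/
theorem isAdmissible_iff (hα₀ : 0 < α) (hα₁ : α < 1) (hT : 0 < T) :
    IsAdmissible α K T a c x₀ x u ↔ u ∈ controls d K T ∧ IntegrableOn x (Icc 0 T) ∧
      ∀ᵐ t ∂volume.restrict (Icc 0 T), x t = rlIntegral α (fun τ ↦ field a c (x τ) (u τ)) t +
        (1 / t ^ (1 - α)) • (1 / Gamma α) • x₀ := by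
  refine and_congr_right fun hu ↦ ⟨fun h ↦ ?_, fun h ↦ ?_⟩
  · exact (hasRLDerivWithInit_iff hα₀ hα₁ hT (integrableOn_field h.1 hu.1) x₀).1 h
  · exact (hasRLDerivWithInit_iff hα₀ hα₁ hT (integrableOn_field h.1 hu.1) x₀).2 h

theorem exists_isAdmissible (hα₀ : 0 < α) (hα₁ : α < 1) (hT : 0 < T)
    (a : Fin N → Fin N → ℝ) (c : Fin N → ℝ) (x₀ : State N d)
    (hu : u ∈ controls d K T) : ∃ x, IsAdmissible α K T a c x₀ x u := by
  obtain ⟨A, B, hAB⟩ := exists_field_eq (d := d) a c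
  obtain ⟨x, hx, h⟩ := exists_volterra_solution hα₀ A (B.integrable_comp hu.1)
    (integrableOn_one_div_rpow_smul (T := T) hα₀ ((1 / Gamma α) • x₀))
  refine ⟨x, (isAdmissible_iff hα₀ hα₁ hT).2 ⟨hu, hx, ?_⟩⟩
  simpa only [hAB] using h

/-- Trajectories depend continuously on the control, in `L¹`. -/
theorem exists_isAdmissible_stability (hα₀ : 0 < α) (hα₁ : α < 1) (hT : 0 < T)
    (a : Fin N → Fin N → ℝ) (c : Fin N → ℝ) :
    ∃ C : ℝ, ∀ (x₀ : State N d) (x y : ℝ → State N d) (u v : ℝ → EuclideanSpace ℝ (Fin d)),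
      IsAdmissible α K T a c x₀ x u → IsAdmissible α K T a c x₀ y v →
        ∫ t in Icc 0 T, ‖x t - y t‖ ≤ C * ∫ t in Icc 0 T, ‖u t - v t‖ := by
  obtain ⟨A, B, hAB⟩ := exists_field_eq (d := d) a c
  obtain ⟨C, hC⟩ := exists_volterra_stability (T := T) hα₀ A
  -- The stability constant comes without a sign, hence the absolute value.
  refine ⟨|C| * ‖B‖, fun x₀ x y u v hx hy ↦ ?_⟩
  rw [isAdmissible_iff hα₀ hα₁ hT] at hx hy
  simp only [hAB] at hx hy
  have hBu := B.integrable_comp hx.1.1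
  have hBv := B.integrable_comp hy.1.1
  have hle : ∫ t in Icc 0 T, ‖B (u t) - B (v t)‖ ≤ ‖B‖ * ∫ t in Icc 0 T, ‖u t - v t‖ := by
    rw [← integral_const_mul]
    refine integral_mono (hBu.sub hBv).norm ((hx.1.1.sub hy.1.1).norm.const_mul _) fun t ↦ ?_
    simp only [← map_sub]
    exact B.le_opNorm _
  calc _ ≤ C * ∫ t in Icc 0 T, ‖B (u t) - B (v t)‖ :=
        hC x y _ _ _ hx.2.1 hy.2.1 hBu hBv hx.2.2 hy.2.2
    _ ≤ |C| * ∫ t in Icc 0 T, ‖B (u t) - B (v t)‖ :=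
        mul_le_mul_of_nonneg_right (le_abs_self C) (integral_nonneg fun t ↦ norm_nonneg _)
    _ ≤ |C| * (‖B‖ * ∫ t in Icc 0 T, ‖u t - v t‖) := by gcongr
    _ = _ := by ring

/-- The system is linear, both pairs share the initial value, and the ball of controls is convex. -/
theorem IsAdmissible.midpoint (hα₀ : 0 < α) (hα₁ : α < 1) (hT : 0 < T)
    (hx : IsAdmissible α K T a c x₀ x u) (hy : IsAdmissible α K T a c x₀ y v) :
    IsAdmissible α K T a c x₀ (fun t ↦ (1 / 2 : ℝ) • x t + (1 / 2 : ℝ) • y t)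
      (fun t ↦ (1 / 2 : ℝ) • u t + (1 / 2 : ℝ) • v t) := by
  obtain ⟨A, B, hAB⟩ := exists_field_eq (d := d) a c
  rw [isAdmissible_iff hα₀ hα₁ hT] at hx hy ⊢
  obtain ⟨⟨hu, huK⟩, hx, hxe⟩ := hx
  obtain ⟨⟨hv, hvK⟩, hy, hye⟩ := hy
  refine ⟨⟨(hu.smul (1 / 2 : ℝ)).add (hv.smul (1 / 2 : ℝ)), fun t ht ↦ ?_⟩,
    (hx.smul (1 / 2 : ℝ)).add (hy.smul (1 / 2 : ℝ)), ?_⟩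
  · refine (norm_add_le _ _).trans ?_
    rw [norm_smul, norm_smul, norm_of_nonneg (by norm_num)]
    linarith [huK t ht, hvK t ht]
  · filter_upwards [hxe, hye, rlIntegral_linear_ae hα₀ (integrableOn_field (a := a) (c := c) hx hu)
      (integrableOn_field (a := a) (c := c) hy hv) (1 / 2) (1 / 2)] with t h₁ h₂ h₃
    have e : (fun τ ↦ field a c ((1 / 2 : ℝ) • x τ + (1 / 2 : ℝ) • y τ)
        ((1 / 2 : ℝ) • u τ + (1 / 2 : ℝ) • v τ)) =
        fun τ ↦ (1 / 2 : ℝ) • field a c (x τ) (u τ) + (1 / 2 : ℝ) • field a c (y τ) (v τ) := by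
      ext τ : 1
      simp only [hAB, map_add, map_smul, smul_add]
      abel
    rw [e, h₃, h₁, h₂]
    module

/-- A bootstrap: the integral equation puts `x` in `L^p`, so the right-hand side of the system is in
`L^p` and serves as the density `g`. -/
theorem IsAdmissible.memRLSpace (hα₀ : 0 < α) (hα₁ : α < 1) (hT : 0 < T) {p : ℝ} (hp : 1 ≤ p)
    (hpα : p * (1 - α) < 1) (hx : IsAdmissible α K T a c x₀ x u) : MemRLSpace α p T x := by
  obtain ⟨A, B, hAB⟩ := exists_field_eq (d := d) a c
  obtain ⟨⟨hu, huK⟩, hx, hxe⟩ := (isAdmissible_iff hα₀ hα₁ hT).1 hx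
  refine ⟨fun t ↦ field a c (x t) (u t), ?_, (1 / Gamma α) • x₀, hxe⟩
  have hxp : MemLp x (ENNReal.ofReal p) (volume.restrict (Icc 0 T)) := by
    refine ((memLp_rlIntegral hα₀ hp hpα (integrableOn_field (a := a) (c := c) hx hu)).add
      (memLp_one_div_rpow_smul hα₀ hp hpα ((1 / Gamma α) • x₀))).ae_eq ?_
    filter_upwards [hxe] with t ht
    exact ht.symm
  have hup : MemLp u (ENNReal.ofReal p) (volume.restrict (Icc 0 T)) := by
    refine MemLp.of_bound hu.1 K ?_
    filter_upwards [ae_restrict_mem measurableSet_Icc] with t ht using huK t ht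
  simp only [hAB]
  exact (A.comp_memLp' hxp).add (B.comp_memLp' hup)

theorem integrableOn_norm_sub_sq (hu : u ∈ controls d K T) (hv : v ∈ controls d K T) :
    IntegrableOn (fun t ↦ ‖u t - v t‖ ^ 2) (Icc 0 T) := by
  refine Integrable.mono' (g := fun _ ↦ (2 * K) ^ 2) (integrable_const _)
    ((hu.1.sub hv.1).1.norm.pow 2) ?_
  filter_upwards [ae_restrict_mem measurableSet_Icc] with t ht
  rw [norm_of_nonneg (by positivity)]
  gcongr
  refine (norm_sub_le _ _).trans ?_
  linarith [hu.2 t ht, hv.2 t ht]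

/-- Uniform convexity of the cost in the control. -/
theorem cost_midpoint_le (hν : 0 ≤ ν) (hx : IntegrableOn x (Icc 0 T))
    (hu : u ∈ controls d K T) (hv : v ∈ controls d K T) :
    2 * cost ν T (fun t ↦ (1 / 2 : ℝ) • x t + (1 / 2 : ℝ) • y t)
      (fun t ↦ (1 / 2 : ℝ) • u t + (1 / 2 : ℝ) • v t) +
        ENNReal.ofReal (ν / 4 * ∫ t in Icc 0 T, ‖u t - v t‖ ^ 2) ≤
      cost ν T x u + cost ν T y v := by
  have hsq : IntegrableOn (fun t ↦ ν / 4 * ‖u t - v t‖ ^ 2) (Icc 0 T) :=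
    (integrableOn_norm_sub_sq hu hv).const_mul _
  unfold cost
  rw [← integral_const_mul, ofReal_integral_eq_lintegral_ofReal hsq
      (.of_forall fun t ↦ by positivity),
    ← lintegral_add_left' (aemeasurable_runningCost hx hu.1),
    ← lintegral_const_mul' _ _ ENNReal.ofNat_ne_top]
  -- Superadditivity of the lower integral suffices here, so no measurability of the midpoint is
  -- needed.
  refine (le_lintegral_add _ _).trans (lintegral_mono fun t ↦ ?_)
  have h := runningCost_midpoint_le (ν := ν) (x t) (y t) (u t) (v t)
  have n := runningCost_nonneg hν ((1 / 2 : ℝ) • x t + (1 / 2 : ℝ) • y t)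
    ((1 / 2 : ℝ) • u t + (1 / 2 : ℝ) • v t)
  rw [← ENNReal.ofReal_add (runningCost_nonneg hν _ _) (runningCost_nonneg hν _ _)]
  refine le_trans (le_of_eq ?_) (ENNReal.ofReal_le_ofReal h)
  rw [ENNReal.ofReal_add (by positivity) (by positivity), ENNReal.ofReal_mul two_pos.le,
    ENNReal.ofReal_ofNat]

/-- Pointwise `r ≤ ε + r² / ε`; this replaces Cauchy–Schwarz in passing from `L²` to `L¹`. -/
theorem integral_norm_sub_le (hT : 0 ≤ T) (hu : u ∈ controls d K T) (hv : v ∈ controls d K T)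
    {ε : ℝ} (hε : 0 < ε) :
    ∫ t in Icc 0 T, ‖u t - v t‖ ≤ ε * T + 1 / ε * ∫ t in Icc 0 T, ‖u t - v t‖ ^ 2 := by
  have hsq := integrableOn_norm_sub_sq hu hv
  have hconst : ∫ _ in Icc 0 T, ε = ε * T := by
    simp [hT, mul_comm]
  rw [← hconst, ← integral_const_mul, ← integral_add (integrable_const _) (hsq.const_mul _)]
  refine integral_mono (hu.1.sub hv.1).norm ((integrable_const _).add (hsq.const_mul _))
    fun t ↦ ?_
  change ‖u t - v t‖ ≤ ε + 1 / ε * ‖u t - v t‖ ^ 2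
  rw [one_div_mul_eq_div, ← sub_le_iff_le_add', le_div_iff₀ hε]
  nlinarith [sq_nonneg (‖u t - v t‖ - ε), norm_nonneg (u t - v t), sq_nonneg ‖u t - v t‖,
    mul_nonneg hε.le (norm_nonneg (u t - v t))]

open Filter in
open scoped Topology in
/-- Minimizing sequences of controls are Cauchy in `L¹`. -/
theorem exists_integral_norm_sub_lt (hα₀ : 0 < α) (hα₁ : α < 1) (hT : 0 < T) (hν : 0 < ν)
    {m : ENNReal} (hm : m ≠ ⊤) (hmin : ∀ x u, IsAdmissible α K T a c x₀ x u → m ≤ cost ν T x u)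
    {y : ℕ → ℝ → State N d} {v : ℕ → ℝ → EuclideanSpace ℝ (Fin d)}
    (hyv : ∀ n, IsAdmissible α K T a c x₀ (y n) (v n))
    (hlim : Tendsto (fun n ↦ cost ν T (y n) (v n)) atTop (𝓝 m)) {ρ : ℝ} (hρ : 0 < ρ) :
    ∃ n₀, ∀ n ≥ n₀, ∀ k ≥ n₀, ∫ t in Icc 0 T, ‖v n t - v k t‖ < ρ := by
  -- `ε` gives `ε T < ρ / 2`, and `η` is such that `2 η = (ν / 4) (ε ρ / 2)`, which leaves `ρ / 2`
  -- for the quadratic term.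
  set ε := ρ / (2 * (T + 1)) with hε_def
  have hε : 0 < ε := by positivity
  set η := ν / 8 * (ε * (ρ / 2)) with hη_def
  have hη : 0 < η := by positivity
  have hev := (tendsto_order.1 hlim).2 (m + ENNReal.ofReal η)
    (ENNReal.lt_add_right hm (by simpa using hη))
  obtain ⟨n₀, hn₀⟩ := eventually_atTop.1 hev
  refine ⟨n₀, fun n hn k hk ↦ ?_⟩
  have h₁ := cost_midpoint_le (y := y k) hν.le (hyv n).2.1 (hyv n).1 (hyv k).1
  have h₂ := hmin _ _ ((hyv n).midpoint hα₀ hα₁ hT (hyv k))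
  -- The midpoint costs at least `m` and both pairs cost at most `m + η`; as `m` is finite, `2 m`
  -- cancels.
  have h₃ : 2 * m + ENNReal.ofReal (ν / 4 * ∫ t in Icc 0 T, ‖v n t - v k t‖ ^ 2) ≤
      2 * m + ENNReal.ofReal (2 * η) :=
    calc _ ≤ _ := by gcongr
      _ ≤ _ := h₁
      _ ≤ (m + ENNReal.ofReal η) + (m + ENNReal.ofReal η) := by
        gcongr
        · exact (hn₀ n hn).le
        · exact (hn₀ k hk).le
      _ = _ := by
        rw [ENNReal.ofReal_mul two_pos.le, ENNReal.ofReal_ofNat]; ring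
  have h₄ := (ENNReal.ofReal_le_ofReal_iff (by positivity)).1
    ((ENNReal.add_le_add_iff_left (ENNReal.mul_ne_top ENNReal.ofNat_ne_top hm)).1 h₃)
  have h₅ : ∫ t in Icc 0 T, ‖v n t - v k t‖ ^ 2 ≤ ε * (ρ / 2) := by
    refine le_of_mul_le_mul_left ?_ (show 0 < ν / 4 by positivity)
    rw [hη_def] at h₄
    linarith
  have h₆ := integral_norm_sub_le hT.le (hyv n).1 (hyv k).1 hε
  have h₇ : 1 / ε * ∫ t in Icc 0 T, ‖v n t - v k t‖ ^ 2 ≤ ρ / 2 := by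
    rw [one_div_mul_eq_div, div_le_iff₀ hε]; linarith
  have h₈ : ε * T < ρ / 2 := by
    have : ε * (T + 1) = ρ / 2 := by rw [hε_def]; field_simp
    linarith
  linarith

open Filter in
open scoped Topology in
/-- Lower semicontinuity of the cost under a.e. convergence. -/
theorem cost_le_of_tendsto_ae {y : ℕ → ℝ → State N d}
    {v : ℕ → ℝ → EuclideanSpace ℝ (Fin d)} (hy : ∀ n, IntegrableOn (y n) (Icc 0 T))
    (hv : ∀ n, IntegrableOn (v n) (Icc 0 T))
    (hyx : ∀ᵐ t ∂volume.restrict (Icc 0 T), Tendsto (fun n ↦ y n t) atTop (𝓝 (x t)))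
    (hvu : ∀ᵐ t ∂volume.restrict (Icc 0 T), Tendsto (fun n ↦ v n t) atTop (𝓝 (u t)))
    {m : ENNReal} (hlim : Tendsto (fun n ↦ cost ν T (y n) (v n)) atTop (𝓝 m)) :
    cost ν T x u ≤ m := by
  -- Fatou's lemma; the running cost is continuous and nonnegative.
  have hF := lintegral_liminf_le' (u := atTop)
    (fun n ↦ aemeasurable_runningCost (ν := ν) (hy n) (hv n))
  refine le_trans (le_of_eq (lintegral_congr_ae ?_)) (hF.trans_eq hlim.liminf_eq)
  filter_upwards [hyx, hvu] with t h₁ h₂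
  exact (ENNReal.tendsto_ofReal (((continuous_runningCost ν).tendsto (x t, u t)).comp
    (h₁.prodMk_nhds h₂))).liminf_eq.symm

open Filter in
open scoped Topology in
/-- The optimal control problem has a solution. -/
theorem exists_isAdmissible_forall_cost_le (hα₀ : 0 < α) (hα₁ : α < 1) (hT : 0 < T)
    (hK : 0 ≤ K) (hν : 0 < ν) (a : Fin N → Fin N → ℝ) (c : Fin N → ℝ) (x₀ : State N d) :
    ∃ x u, IsAdmissible α K T a c x₀ x u ∧
      ∀ y v, IsAdmissible α K T a c x₀ y v → cost ν T x u ≤ cost ν T y v := by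
  let S : Set ENNReal := {r | ∃ y v, IsAdmissible α K T a c x₀ y v ∧ cost ν T y v = r}
  have hzero : (fun _ ↦ 0) ∈ controls d K T := ⟨integrable_const _, fun t _ ↦ by simpa using hK⟩
  obtain ⟨z, hz⟩ := exists_isAdmissible hα₀ hα₁ hT a c x₀ hzero
  have hmin : ∀ y v, IsAdmissible α K T a c x₀ y v → sInf S ≤ cost ν T y v :=
    fun y v h ↦ sInf_le ⟨y, v, h, rfl⟩
  -- The infimum may be infinite, since `t^{α-1}` is not square integrable for `α ≤ 1/2`; then every
  -- admissible pair is a minimizer.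
  by_cases hm : sInf S = ⊤
  · refine ⟨z, _, hz, fun y v h ↦ ?_⟩
    have := hmin y v h
    rw [hm] at this
    exact le_top.trans this
  obtain ⟨r, -, hr, hrS⟩ := exists_seq_tendsto_sInf (S := S) ⟨_, z, _, hz, rfl⟩ (OrderBot.bddBelow S)
  choose y v hyv hcost using hrS
  replace hr := hr.congr fun n ↦ (hcost n).symm
  obtain ⟨w, hw, hvw⟩ := exists_integrable_tendsto_of_cauchy (fun n ↦ (hyv n).1.1)
    fun ρ hρ ↦ exists_integral_norm_sub_lt hα₀ hα₁ hT hν hm hmin hyv hr hρ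
  obtain ⟨ns, hns, hvae⟩ := exists_subseq_tendsto_ae_of_integral_norm
    (fun n ↦ (hyv n).1.1) hw hvw
  have hwK : ∀ᵐ t ∂volume.restrict (Icc 0 T), ‖w t‖ ≤ K := by
    filter_upwards [hvae, ae_restrict_mem measurableSet_Icc] with t h ht
    exact le_of_tendsto' h.norm fun i ↦ (hyv _).1.2 t ht
  -- The limit satisfies the bound only a.e., while `controls` asks for it at every point of
  -- `[0,T]`.
  let u : ℝ → EuclideanSpace ℝ (Fin d) := fun t ↦ if ‖w t‖ ≤ K then w t else 0
  have huw : ∀ᵐ t ∂volume.restrict (Icc 0 T), w t = u t := by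
    filter_upwards [hwK] with t ht
    simp [u, ht]
  have hu : u ∈ controls d K T := by
    refine ⟨hw.congr huw, fun t _ ↦ ?_⟩
    by_cases h : ‖w t‖ ≤ K <;> simp [u, h, hK]
  have hvu : Tendsto (fun n ↦ ∫ t in Icc 0 T, ‖v n t - u t‖) atTop (𝓝 0) := by
    refine hvw.congr fun n ↦ integral_congr_ae ?_
    filter_upwards [huw] with t ht
    rw [ht]
  obtain ⟨x, hx⟩ := exists_isAdmissible hα₀ hα₁ hT a c x₀ hu
  obtain ⟨C, hC⟩ := exists_isAdmissible_stability (d := d) (K := K) hα₀ hα₁ hT a c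
  have hyx : Tendsto (fun n ↦ ∫ t in Icc 0 T, ‖y n t - x t‖) atTop (𝓝 0) := by
    refine squeeze_zero (fun n ↦ integral_nonneg fun t ↦ norm_nonneg _)
      (fun n ↦ hC x₀ _ _ _ _ (hyv n) hx) ?_
    simpa using hvu.const_mul C
  -- Extracted along `ns`, so that states and controls converge a.e. along the same indices.
  obtain ⟨ks, hks, hyae⟩ := exists_subseq_tendsto_ae_of_integral_norm
    (fun i ↦ (hyv (ns i)).2.1) hx.2.1 (hyx.comp hns.tendsto_atTop)
  refine ⟨x, u, hx, fun y' v' h ↦ le_trans ?_ (hmin y' v' h)⟩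
  refine cost_le_of_tendsto_ae (fun i ↦ (hyv (ns (ks i))).2.1) (fun i ↦ (hyv (ns (ks i))).1.1)
    hyae ?_ (hr.comp (hns.comp hks).tendsto_atTop)
  filter_upwards [hvae, huw] with t h₁ h₂
  rw [← h₂]
  exact h₁.comp hks.tendsto_atTop

end Admissible

end HegselmannKrause

theorem mainTheorem1 (N d : ℕ) (hN : 1 < N) (hd : 1 ≤ d)
    (α p T K ν : ℝ) (hα₀ : 0 < α) (hα₁ : α < 1) (hp : 1 < p) (hpα : p < 1 / (1 - α))
    (hT : 0 < T) (hK : 0 ≤ K) (hν : 0 < ν)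
    (a : Fin N → Fin N → ℝ) (ha : ∀ i j, 0 ≤ a i j) (c : Fin N → ℝ) (hc : ∀ i, 0 ≤ c i)
    (x₀ : HegselmannKrause.State N d) :
    ∃ (x : ℝ → HegselmannKrause.State N d) (u : ℝ → EuclideanSpace ℝ (Fin d)),
      MemRLSpace α p T x ∧
      HegselmannKrause.IsAdmissible α K T a c x₀ x u ∧
      ∀ (y : ℝ → HegselmannKrause.State N d) (v : ℝ → EuclideanSpace ℝ (Fin d)),
        HegselmannKrause.IsAdmissible α K T a c x₀ y v →
          HegselmannKrause.cost ν T x u ≤ HegselmannKrause.cost ν T y v := by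
  obtain ⟨x, u, hxu, hmin⟩ := HegselmannKrause.exists_isAdmissible_forall_cost_le
    hα₀ hα₁ hT hK hν a c x₀
  have hpα' : p * (1 - α) < 1 := by rwa [lt_div_iff₀ (sub_pos.2 hα₁)] at hpα
  exact ⟨x, u, hxu.memRLSpace hα₀ hα₁ hT hp.le hpα', hxu, hmin⟩
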